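/- Let $t\ge 2$ be an integer. Call a finite set $X\subset\mathbb R^d$ a Gaussian $t$-design in $\mathbb R^d$ if there is a positive weight function $w:X\to\mathbb R_{>0}$ such that $$\frac{1}{\pi^{d/2}}\int_{\mathbb R^d} f(\omega)\,e^{-\sum_{i=1}^d\omega_i^2}\,d\omega_1\cdots d\omega_d=\sum_{x\in X}w(x)f(x)$$ for every real polynomial $f$ in $d$ variables of total degree at most $t$. Then there exists a positive integer $M$, depending only on $t$, such that for every prime power $q\ge M$ and every integer $d\ge t$ there exists a Gaussian $t$-design in $\mathbb R^d$ with exactly $N=N(d)$ points, where $$N<q^t d^{t-1};$$ in particular, for fixed $t$ and $q$, $N=O(d^{t-1})$ as $d\to\infty$. -/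

import Mathlib

/-- A weighted `t`-design in `ℝ^d` with respect to the measure `μ`: a finite set `X ⊆ ℝ^d` of
points with positive weights `w` on `X` such that every real polynomial `f` in `d` variables of
total degree at most `t` is `μ`-integrable and satisfies `∫ f dμ = ∑_{x ∈ X} w(x) f(x)`. -/
def IsWeightedDesign {d : ℕ} (t : ℕ) (μ : MeasureTheory.Measure (Fin d → ℝ))
    (X : Finset (Fin d → ℝ)) (w : (Fin d → ℝ) → ℝ) : Prop :=
  (∀ x ∈ X, 0 < w x) ∧
    ∀ f : MvPolynomial (Fin d) ℝ, f.totalDegree ≤ t →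
      MeasureTheory.Integrable (fun x : Fin d → ℝ => MvPolynomial.eval x f) μ ∧
        ∫ x, MvPolynomial.eval x f ∂μ = ∑ x ∈ X, w x * MvPolynomial.eval x f

/-- The Gaussian measure `π^{-d/2} exp(-(ω₁² + ⋯ + ω_d²)) dω₁ ⋯ dω_d` on `ℝ^d`. -/
noncomputable def gaussianMeasure (d : ℕ) : MeasureTheory.Measure (Fin d → ℝ) :=
  MeasureTheory.volume.withDensity fun x =>
    ENNReal.ofReal (Real.pi ^ (-(d : ℝ) / 2) * Real.exp (-∑ i, x i ^ 2))

/-- A Gaussian `t`-design in `ℝ^d`: a finite set `X ⊆ ℝ^d` that carries positive weights making it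
a weighted `t`-design with respect to the Gaussian measure. -/
def IsGaussianDesign {d : ℕ} (t : ℕ) (X : Finset (Fin d → ℝ)) : Prop :=
  ∃ w : (Fin d → ℝ) → ℝ, IsWeightedDesign t (gaussianMeasure d) X w

/-! The Gaussian measure is the product of `d` copies of γ = N(0, 1/2), and a monomial of degree at
most `t` involves at most `t` coordinates. If `2 ^ n` equally weighted reals match the moments of γ
up to order `t` (`exists_dyadic_uniform_moments`), it suffices to label with them the rows of an
orthogonal array of strength `t` over F_2^n. Such an array comes from evaluating polynomials of
degree below `t` at `d` points of a field `K` of characteristic 2 and projecting additively onto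
F_2^n (`arraySymbol_average_prod`). Only the projection of the constant term matters, so there are
`2 ^ n * |K| ^ (t - 1)` rows, with `|K|` at most `2 ^ (n + 1) * d`. The construction does not depend
on `q`. -/

section DyadicMoments

/-! ### Equal-weight quadrature on a dyadic number of points. -/

open scoped Pointwise

/-- The vectors of moments of orders `1, …, t` of the uniform distributions on real multisets
whose cardinality is a power of two. -/
def dyadicMoments (t : ℕ) : Set (Fin t → ℝ) :=
  {v | ∃ (ι : Type) (_ : Fintype ι) (n : ℕ) (φ : ι → ℝ), Fintype.card ι = 2 ^ n ∧
    v = fun j : Fin t => (∑ i, φ i ^ ((j : ℕ) + 1)) / 2 ^ n}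

theorem moments_single_mem_dyadicMoments (t : ℕ) (x : ℝ) :
    (fun j : Fin t => x ^ ((j : ℕ) + 1)) ∈ dyadicMoments t :=
  ⟨Unit, inferInstance, 0, fun _ => x, by simp, by simp⟩

/-- Mix the two multisets: of `2 ^ n` copies of `ι × κ`, `m` carry `φ` and the others `ψ`. -/
theorem dyadicMoments_combination {t : ℕ} {v w : Fin t → ℝ} (hv : v ∈ dyadicMoments t)
    (hw : w ∈ dyadicMoments t) {m n : ℕ} (hm : m ≤ 2 ^ n) :
    ((m : ℝ) / 2 ^ n) • v + (1 - (m : ℝ) / 2 ^ n) • w ∈ dyadicMoments t := by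
  obtain ⟨ι, _, a, φ, hι, rfl⟩ := hv
  obtain ⟨κ, _, b, ψ, hκ, rfl⟩ := hw
  refine ⟨ι × κ × Fin (2 ^ n), inferInstance, a + b + n,
    fun p => if (p.2.2 : ℕ) < m then φ p.1 else ψ p.2.1, ?_, ?_⟩
  · simp [hι, hκ, pow_add, mul_assoc]
  · funext j
    have hcount : (Finset.univ.filter fun k : Fin (2 ^ n) => (k : ℕ) < m).card = m := by
      rw [Fin.card_filter_val_lt, min_eq_right hm]
    have hcount' : (Finset.univ.filter fun k : Fin (2 ^ n) => ¬ (k : ℕ) < m).card = 2 ^ n - m := by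
      have := Finset.card_filter_add_card_filter_not (s := (Finset.univ : Finset (Fin (2 ^ n))))
        (fun k : Fin (2 ^ n) => (k : ℕ) < m)
      rw [hcount, Finset.card_univ, Fintype.card_fin] at this
      omega
    simp only [Fintype.sum_prod_type, ite_pow]
    simp only [Finset.sum_ite, Finset.sum_const, hcount, hcount',
      Finset.sum_add_distrib, Finset.card_univ, hι, hκ, nsmul_eq_mul, ← Finset.mul_sum,
      Pi.add_apply, Pi.smul_apply, smul_eq_mul]
    push_cast [hm]
    field_simp
    ring

theorem convex_closure_dyadicMoments (t : ℕ) : Convex ℝ (closure (dyadicMoments t)) := by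
  intro v hv w hw a b ha hb hab
  obtain rfl : b = 1 - a := by linarith
  rw [← closure_closure]
  refine map_mem_closure₂ (f := fun v w : Fin t → ℝ => a • v + (1 - a) • w) (by fun_prop) hv hw ?_
  intro v hv w hw
  have hlim : Filter.Tendsto (fun n : ℕ => ((⌊a * (2 : ℝ) ^ n⌋₊ : ℕ) : ℝ) / 2 ^ n)
      Filter.atTop (nhds a) :=
    (tendsto_nat_floor_mul_div_atTop ha).comp (tendsto_pow_atTop_atTop_of_one_lt one_lt_two)
  refine mem_closure_of_tendsto ((hlim.smul_const v).add
    ((tendsto_const_nhds (x := (1 : ℝ)).sub hlim).smul_const w)) (Filter.Eventually.of_forall ?_)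
  intro n
  refine dyadicMoments_combination hv hw (Nat.floor_le_of_le ?_)
  push_cast
  exact mul_le_of_le_one_left (by positivity) (by linarith)

theorem powerSum_hasStrictFDerivAt (t : ℕ) (x : Fin t → ℝ) :
    HasStrictFDerivAt (fun (x : Fin t → ℝ) (j : Fin t) => ∑ i, x i ^ ((j : ℕ) + 1))
      (Matrix.mulVecLin (Matrix.of fun j i : Fin t => (((j : ℕ) + 1 : ℝ)) * x i ^ (j : ℕ))).toContinuousLinearMap
      x := by
  rw [hasStrictFDerivAt_pi']
  intro j
  have h : ∀ i ∈ (Finset.univ : Finset (Fin t)), HasStrictFDerivAt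
      (fun x : Fin t → ℝ => x i ^ ((j : ℕ) + 1)) _ x := fun i _ =>
    (ContinuousLinearMap.hasStrictFDerivAt
      (ContinuousLinearMap.proj (R := ℝ) (φ := fun _ : Fin t => ℝ) i)).pow ((j : ℕ) + 1)
  refine (HasStrictFDerivAt.fun_sum h).congr_fderiv ?_
  ext v
  simp [Matrix.mulVec, dotProduct]

theorem powerSum_derivative_surjective {t : ℕ} {x : Fin t → ℝ} (hx : Function.Injective x) :
    Function.Surjective
      (Matrix.mulVecLin (Matrix.of fun j i : Fin t => (((j : ℕ) + 1 : ℝ)) * x i ^ (j : ℕ))) := by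
  have hM : (Matrix.of fun j i : Fin t => (((j : ℕ) + 1 : ℝ)) * x i ^ (j : ℕ)) =
      Matrix.diagonal (fun j : Fin t => ((j : ℕ) + 1 : ℝ)) * (Matrix.vandermonde x).transpose := by
    ext j i
    simp [Matrix.diagonal_mul, Matrix.vandermonde]
  have h : Function.Surjective
      (Matrix.of fun j i : Fin t => (((j : ℕ) + 1 : ℝ)) * x i ^ (j : ℕ)).mulVec := by
    rw [Matrix.mulVec_surjective_iff_isUnit, Matrix.isUnit_iff_isUnit_det, hM, Matrix.det_mul,
      Matrix.det_transpose, Matrix.det_diagonal, isUnit_iff_ne_zero]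
    refine mul_ne_zero (Finset.prod_ne_zero_iff.2 fun j _ => by positivity)
      (Matrix.det_vandermonde_ne_zero_iff.2 hx)
  exact h

/-- At distinct nodes the Jacobian of the power sums is an invertible diagonal matrix times a
Vandermonde matrix, so the power-sum map is open there. -/
theorem interior_dyadicMoments_nonempty (t : ℕ) : (interior (dyadicMoments t)).Nonempty := by
  set x : Fin t → ℝ := fun i => (i : ℕ) with hx_def
  have hx : Function.Injective x := fun i j h => Fin.ext (by simpa [hx_def] using h)
  have hopen := (powerSum_hasStrictFDerivAt t x).map_nhds_eq_of_surj
    (LinearMap.range_eq_top.2 (powerSum_derivative_surjective hx))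
  have hrange : Set.range (fun (x : Fin t → ℝ) (j : Fin t) => ∑ i, x i ^ ((j : ℕ) + 1)) ∈
      nhds (fun j : Fin t => ∑ i, x i ^ ((j : ℕ) + 1)) := by
    rw [← hopen]
    exact Filter.range_mem_map
  have hsub : ((2 : ℝ) ^ t)⁻¹ •
      Set.range (fun (x : Fin t → ℝ) (j : Fin t) => ∑ i, x i ^ ((j : ℕ) + 1)) ⊆
      dyadicMoments t := by
    rintro _ ⟨_, ⟨y, rfl⟩, rfl⟩
    -- Padding with zeros reaches `2 ^ t` points; only orders at least 1 occur, so the power sums do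
    -- not change.
    refine ⟨Fin t ⊕ Fin (2 ^ t - t), inferInstance, t, Sum.elim y 0, ?_, ?_⟩
    · have := (Nat.lt_two_pow_self (n := t)).le
      simp [this]
    · funext j
      simp [div_eq_inv_mul]
  refine ⟨((2 : ℝ) ^ t)⁻¹ • (fun j : Fin t => ∑ i, x i ^ ((j : ℕ) + 1)), mem_interior_iff_mem_nhds.2
    (Filter.mem_of_superset ?_ hsub)⟩
  exact (smul_mem_nhds_smul_iff₀ (by positivity)).2 hrange

/-- Every interior point of the closure of the dyadic moment set is itself a dyadic moment
vector. -/
theorem interior_closure_dyadicMoments_subset (t : ℕ) :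
    interior (closure (dyadicMoments t)) ⊆ dyadicMoments t := by
  intro m hm
  obtain ⟨p, hp⟩ := interior_dyadicMoments_nonempty t
  have hε : Filter.Tendsto (fun n : ℕ => (((1 : ℕ) : ℝ) / 2 ^ n)) Filter.atTop (nhds 0) := by
    simpa [div_eq_mul_inv, Function.comp_def] using tendsto_inv_atTop_zero.comp
      (tendsto_pow_atTop_atTop_of_one_lt (one_lt_two (α := ℝ)))
  have hy : Filter.Tendsto (fun n : ℕ => (1 - (((1 : ℕ) : ℝ) / 2 ^ n))⁻¹ •
      (m - (((1 : ℕ) : ℝ) / 2 ^ n) • p)) Filter.atTop (nhds m) := by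
    have := ((tendsto_const_nhds (x := (1 : ℝ)).sub hε).inv₀ (by simp)).smul
      ((tendsto_const_nhds (x := m)).sub (hε.smul_const p))
    simpa using this
  obtain ⟨n, hn, hn1⟩ := ((hy.eventually (isOpen_interior.mem_nhds hm)).and
    (Filter.eventually_ge_atTop 1)).exists
  set e : ℝ := ((1 : ℕ) : ℝ) / 2 ^ n with he
  have he0 : 0 < e := by rw [he]; positivity
  have he1 : e < 1 := by
    rw [he, Nat.cast_one, div_lt_one (by positivity)]
    exact one_lt_pow₀ one_lt_two (by omega)
  -- `y` lies just beyond `m` on the line from `p`, still inside the interior of the closure.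
  set y : Fin t → ℝ := (1 - e)⁻¹ • (m - e • p)
  have hmy : m = e • p + (1 - e) • y := by
    simp [y, smul_smul, mul_inv_cancel₀ (sub_ne_zero.2 he1.ne')]
  have hq : Continuous fun z : Fin t → ℝ => e⁻¹ • (m - (1 - e) • z) := by fun_prop
  have hqy : e⁻¹ • (m - (1 - e) • y) = p := by
    rw [hmy]
    simp [smul_smul, inv_mul_cancel₀ he0.ne']
  -- `y` is only a limit of dyadic moments: replace it by a nearby dyadic `z` and move `p` to
  -- compensate, staying in the interior.
  have hnhds : (fun z : Fin t → ℝ => e⁻¹ • (m - (1 - e) • z)) ⁻¹' interior (dyadicMoments t) ∈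
      nhds y := hq.continuousAt.preimage_mem_nhds (by
    rw [hqy]
    exact isOpen_interior.mem_nhds hp)
  obtain ⟨z, hz, hzK⟩ := mem_closure_iff_nhds.1 (interior_subset hn) _ hnhds
  have hcomb := dyadicMoments_combination (interior_subset hz) hzK (m := 1) (n := n)
    Nat.one_le_two_pow
  rw [← he] at hcomb
  convert hcomb using 1
  simp [smul_smul, mul_inv_cancel₀ he0.ne']

open MeasureTheory in
/-- The moments of a probability measure on `ℝ` with full support are dyadic moments. -/
theorem moments_mem_dyadicMoments (t : ℕ) (γ : Measure ℝ) [IsProbabilityMeasure γ]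
    [γ.IsOpenPosMeasure] (hγ : ∀ j : ℕ, Integrable (fun x : ℝ => x ^ j) γ) :
    (fun j : Fin t => ∫ x, x ^ ((j : ℕ) + 1) ∂γ) ∈ dyadicMoments t := by
  apply interior_closure_dyadicMoments_subset
  set m : Fin t → ℝ := fun j => ∫ x, x ^ ((j : ℕ) + 1) ∂γ with hm_def
  by_contra hm
  obtain ⟨f, hf⟩ := geometric_hahn_banach_open_point
    (convex_closure_dyadicMoments t).interior isOpen_interior hm
  have hint : (interior (closure (dyadicMoments t))).Nonempty :=
    (interior_dyadicMoments_nonempty t).mono (interior_mono subset_closure)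
  have hle : ∀ a ∈ dyadicMoments t, f a ≤ f m := by
    intro a ha
    have hmem : a ∈ closure (interior (closure (dyadicMoments t))) := by
      rw [(convex_closure_dyadicMoments t).closure_interior_eq_closure_of_nonempty_interior hint,
        closure_closure]
      exact subset_closure ha
    exact closure_minimal (t := {a | f a ≤ f m}) (fun b hb => (hf b hb).le)
      (isClosed_le f.continuous continuous_const) hmem
  set c : ℝ → Fin t → ℝ := fun x j => x ^ ((j : ℕ) + 1) with hc
  have hfc : ∀ v, f v = ∑ j, v j * f (Pi.single j 1) := fun v => by
    conv_lhs => rw [pi_eq_sum_univ' v]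
    simp [map_sum]
  -- `f m - f (c x)` is continuous, nonnegative and of integral zero, so full support makes it
  -- vanish identically. Then `f` equals `f m` on every dyadic moment vector, against strict
  -- separation at `p`.
  have hcint : Integrable (fun x => f m - f (c x)) γ := by
    simp only [hfc (c _)]
    exact (integrable_const _).sub (integrable_finsetSum _ fun j _ => (hγ _).mul_const _)
  have hzero : ∫ x, (f m - f (c x)) ∂γ = 0 := by
    simp only [hfc (c _)]
    rw [integral_sub (integrable_const _)
      (integrable_finsetSum _ fun j _ => (hγ _).mul_const _),
      integral_finsetSum _ fun j _ => (hγ _).mul_const _]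
    simp only [integral_mul_const]
    rw [hfc m]
    simp [hm_def]
  have hcont : Continuous fun x => f m - f (c x) := by
    have : Continuous c := by fun_prop
    fun_prop
  have hall := (hcont.ae_eq_iff_eq γ continuous_const).1
    ((integral_eq_zero_iff_of_nonneg (fun x => sub_nonneg.2
      (hle _ (moments_single_mem_dyadicMoments t x))) hcint).1 hzero)
  obtain ⟨p, hp⟩ := interior_dyadicMoments_nonempty t
  have hlt := hf p (interior_mono subset_closure hp)
  obtain ⟨ι, _, n, φ, hι, rfl⟩ := interior_subset hp
  have hsum : (fun j : Fin t => (∑ i, φ i ^ ((j : ℕ) + 1)) / 2 ^ n) =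
      ((2 : ℝ) ^ n)⁻¹ • ∑ i, c (φ i) := by
    funext j
    simp [hc, div_eq_inv_mul]
  have hconst : ∀ x, f (c x) = f m := fun x => (sub_eq_zero.1 (congrFun hall x)).symm
  rw [hsum, map_smul, map_sum] at hlt
  simp [hconst, hι] at hlt

open MeasureTheory in
theorem exists_dyadic_uniform_moments (t : ℕ) (γ : Measure ℝ) [IsProbabilityMeasure γ]
    [γ.IsOpenPosMeasure] (hγ : ∀ j : ℕ, Integrable (fun x : ℝ => x ^ j) γ) :
    ∃ (n : ℕ) (φ : (Fin n → ZMod 2) → ℝ), ∀ j ≤ t,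
      (∑ a, φ a ^ j) / 2 ^ n = ∫ x, x ^ j ∂γ := by
  obtain ⟨ι, _, n, φ, hι, hφ⟩ := moments_mem_dyadicMoments t γ hγ
  have e : (Fin n → ZMod 2) ≃ ι := Fintype.equivOfCardEq (by simp [hι, ZMod.card])
  refine ⟨n, φ ∘ e, fun j hj => ?_⟩
  rw [show ∑ a, (φ ∘ e) a ^ j = ∑ i, φ i ^ j from e.sum_comp fun i => φ i ^ j]
  rcases j with _ | j
  · simp [hι]
  · exact (congrFun hφ ⟨j, hj⟩).symm

end DyadicMoments

/-- Averaging over a finite group along a surjective homomorphism. -/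
theorem sum_comp_surjective_addMonoidHom {G H : Type*} [AddCommGroup G] [AddCommGroup H]
    [Fintype G] [Fintype H] (φ : G →+ H) (hφ : Function.Surjective φ) (f : H → ℝ) :
    (∑ g, f (φ g)) / Fintype.card G = (∑ h, f h) / Fintype.card H := by
  have key : ∀ h : H, ∑ g, f (φ g + h) = ∑ g, f (φ g) := by
    intro h
    obtain ⟨g₀, rfl⟩ := hφ h
    simp only [← map_add]
    exact Equiv.sum_comp (Equiv.addRight g₀) fun g => f (φ g)
  have h1 : ∑ h : H, ∑ g, f (φ g + h) = Fintype.card H * ∑ g, f (φ g) := by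
    simp [key]
  have h2 : ∑ h : H, ∑ g, f (φ g + h) = Fintype.card G * ∑ h, f h := by
    rw [Finset.sum_comm]
    have : ∀ g, ∑ h : H, f (φ g + h) = ∑ h, f h := fun g => Equiv.sum_comp (Equiv.addLeft (φ g)) f
    simp [this]
  have hG : (Fintype.card G : ℝ) ≠ 0 := by simp
  have hH : (Fintype.card H : ℝ) ≠ 0 := by simp
  rw [div_eq_div_iff hG hH]
  linarith

/-! ### Orthogonal arrays from polynomial evaluation. -/

section OrthogonalArray

variable {K A : Type*} [Field K] [AddCommGroup A]

/-- The symbol at the point `x` of the codeword of `(b, c)`: the value at `x` of the polynomial with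
coefficients `c` in positive degrees, projected to `A` and shifted by `b`. -/
def arraySymbol (L : K →+ A) (s : ℕ) (x : K) : A × (Fin s → K) →+ A where
  toFun p := p.1 + L (∑ j, p.2 j * x ^ ((j : ℕ) + 1))
  map_zero' := by simp
  map_add' p q := by
    simp only [Prod.fst_add, Prod.snd_add, Pi.add_apply, add_mul, Finset.sum_add_distrib, map_add]
    abel

/-- The symbols at `s + 1` distinct points take every possible value. -/
theorem arraySymbol_surjective (L : K →+ A) (hL : Function.Surjective L) (s : ℕ) {ι : Type*}
    [Fintype ι] [DecidableEq ι] (hι : Fintype.card ι ≤ s + 1) (x : ι → K) (hx : Function.Injective x) :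
    Function.Surjective (AddMonoidHom.pi fun i => arraySymbol L s (x i)) := by
  intro y
  choose z hz using fun i => hL (y i)
  set P := Lagrange.interpolate Finset.univ x z with hP
  have hdeg : P.natDegree < s + 1 := by
    have hlt : P.degree < ((s + 1 : ℕ) : WithBot ℕ) :=
      (Lagrange.degree_interpolate_lt z hx.injOn).trans_le (by
        rw [Finset.card_univ]
        exact_mod_cast hι)
    rcases eq_or_ne P 0 with h0 | h0
    · simp [h0]
    · exact (Polynomial.natDegree_lt_iff_degree_lt h0).2 hlt
  -- `P` interpolates lifts of the prescribed symbols to `K`.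
  refine ⟨(L (P.coeff 0), fun j => P.coeff (j + 1)), funext fun i => ?_⟩
  have heval : P.coeff 0 + ∑ j : Fin s, P.coeff (j + 1) * x i ^ ((j : ℕ) + 1) = z i := by
    rw [← Lagrange.eval_interpolate_at_node z hx.injOn (Finset.mem_univ i), ← hP,
      Polynomial.eval_eq_sum_range' hdeg, Finset.sum_range_succ', add_comm,
      Finset.sum_range fun j => P.coeff (j + 1) * x i ^ (j + 1)]
    simp
  change L (P.coeff 0) + L (∑ j : Fin s, P.coeff (j + 1) * x i ^ ((j : ℕ) + 1)) = y i
  rw [← map_add, heval, hz]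

/-- The array has strength `s + 1`: monomials in at most `s + 1` variables average over its rows as
they do for independent uniform symbols. -/
theorem arraySymbol_average_prod [Fintype K] [Fintype A] (L : K →+ A)
    (hL : Function.Surjective L) (s : ℕ) {ι : Type*} [DecidableEq ι] (S : Finset ι)
    (hS : S.card ≤ s + 1) (x : ι → K) (hx : Function.Injective x) (g : ι → A → ℝ) :
    (∑ p : A × (Fin s → K), ∏ i ∈ S, g i (arraySymbol L s (x i) p)) /
        Fintype.card (A × (Fin s → K)) =
      ∏ i ∈ S, (∑ a, g i a) / Fintype.card A := by
  classical
  have h := sum_comp_surjective_addMonoidHom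
    (AddMonoidHom.pi fun i : S => arraySymbol L s (x i))
    (arraySymbol_surjective L hL s (by simpa using hS) (fun i : S => x i)
      (hx.comp Subtype.val_injective)) (fun y => ∏ i : S, g i (y i))
  have hattach : ∀ p : A × (Fin s → K), ∏ i ∈ S, g i (arraySymbol L s (x i) p) =
      ∏ i : S, g i (arraySymbol L s (x i) p) := fun p =>
    (Finset.prod_coe_sort S fun i => g i (arraySymbol L s (x i) p)).symm
  simp only [hattach]
  rw [← Finset.prod_coe_sort S fun i => (∑ a, g i a) / (Fintype.card A : ℝ),
    Finset.prod_div_distrib, Finset.prod_univ_sum, Fintype.piFinset_univ, ← Nat.cast_prod, ← Fintype.card_pi]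
  exact h

end OrthogonalArray

theorem exists_field_card_two_pow (n m : ℕ) (hm : m ≠ 0) (hnm : n ≤ m) :
    ∃ (K : Type) (_ : Field K) (_ : Fintype K) (L : K →+ (Fin n → ZMod 2)),
      Fintype.card K = 2 ^ m ∧ Function.Surjective L := by
  have : Fact (Nat.Prime 2) := ⟨Nat.prime_two⟩
  have hcard := GaloisField.card 2 m hm
  have : Finite (GaloisField 2 m) := Nat.finite_of_card_ne_zero (by rw [hcard]; positivity)
  let _ : Fintype (GaloisField 2 m) := Fintype.ofFinite _
  let e : GaloisField 2 m ≃ₗ[ZMod 2] (Fin m → ZMod 2) := (Module.finBasisOfFinrankEq (ZMod 2) (GaloisField 2 m)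
    (GaloisField.finrank 2 hm)).equivFun
  let L := LinearMap.funLeft (ZMod 2) (ZMod 2) (Fin.castLE hnm) ∘ₗ e.toLinearMap
  refine ⟨GaloisField 2 m, inferInstance, inferInstance, L.toAddMonoidHom, ?_, ?_⟩
  · rw [← Nat.card_eq_fintype_card, hcard]
  · exact (LinearMap.funLeft_surjective_of_injective (ZMod 2) (ZMod 2) _ (Fin.castLE_injective hnm)).comp
      e.surjective

/-! ### Gaussian designs from quadratures and arrays. -/

section GaussianDesign

open MeasureTheory ProbabilityTheory

theorem gaussianMeasure_eq_pi (d : ℕ) :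
    gaussianMeasure d = Measure.pi fun _ => gaussianReal 0 (1 / 2) := by
  have hv : (1 / 2 : NNReal) ≠ 0 := by norm_num
  have hdens : ∀ x : Fin d → ℝ, Real.pi ^ (-(d : ℝ) / 2) * Real.exp (-∑ i, x i ^ 2) =
      ∏ i, gaussianPDFReal 0 (1 / 2) (x i) := by
    intro x
    have h1 : (√(2 * Real.pi * ((1 / 2 : NNReal) : ℝ)))⁻¹ = Real.pi ^ (-(1 / 2) : ℝ) := by
      rw [Real.rpow_neg Real.pi_pos.le, ← Real.sqrt_eq_rpow]
      congr 2
      push_cast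
      ring
    simp only [gaussianPDFReal, h1, Finset.prod_mul_distrib, ← Real.exp_sum, Finset.prod_const,
      Finset.card_univ, Fintype.card_fin, ← Real.rpow_natCast, ← Real.rpow_mul Real.pi_pos.le]
    congr 2
    · ring
    · rw [← Finset.sum_neg_distrib]
      exact Finset.sum_congr rfl fun i _ => by push_cast; ring_nf
  refine (Measure.pi_eq fun s hs => ?_).symm
  have hint : ∀ i, Integrable (gaussianPDFReal 0 (1 / 2)) (volume.restrict (s i)) := fun i =>
    (integrable_gaussianPDFReal 0 (1 / 2)).restrict
  rw [gaussianMeasure, withDensity_apply _ (MeasurableSet.univ_pi hs)]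
  simp only [hdens]
  rw [volume_pi, Measure.restrict_pi_pi, ← ofReal_integral_eq_lintegral_ofReal
    (Integrable.fintype_prod hint) (Filter.Eventually.of_forall fun x =>
      Finset.prod_nonneg fun i _ => gaussianPDFReal_nonneg _ _ _),
    integral_fintype_prod_eq_prod fun _ => gaussianPDFReal 0 (1 / 2),
    ENNReal.ofReal_prod_of_nonneg fun i _ =>
      integral_nonneg fun x => gaussianPDFReal_nonneg _ _ _]
  exact Finset.prod_congr rfl fun i _ => (gaussianReal_apply_eq_integral 0 hv (s i)).symm

theorem integrable_pow_gaussianReal (μ : ℝ) (v : NNReal) (j : ℕ) :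
    Integrable (fun x : ℝ => x ^ j) (gaussianReal μ v) :=
  integrable_pow_of_mem_interior_integrableExpSet (X := id)
    (by rw [integrableExpSet_id_gaussianReal, interior_univ]; trivial) j

/-- A measure with the same moments of degree at most `t` as a uniformly distributed finite family
of points has a weighted `t`-design supported on those points. -/
theorem isWeightedDesign_image {d t : ℕ} {μ : Measure (Fin d → ℝ)} {Ω : Type*} [Fintype Ω]
    [Nonempty Ω] (p : Ω → Fin d → ℝ)
    (h : ∀ s : Fin d →₀ ℕ, s.degree ≤ t →
      Integrable (fun x : Fin d → ℝ => ∏ i, x i ^ s i) μ ∧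
        ∫ x, ∏ i, x i ^ s i ∂μ = (∑ ω, ∏ i, p ω i ^ s i) / Fintype.card Ω) :
    IsWeightedDesign t μ (Finset.univ.image p)
      (fun x => ((Finset.univ.filter fun ω => p ω = x).card : ℝ) / Fintype.card Ω) := by
  refine ⟨fun x hx => ?_, fun f hf => ?_⟩
  · obtain ⟨ω, -, rfl⟩ := Finset.mem_image.1 hx
    have : 0 < (Finset.univ.filter fun ω' => p ω' = p ω).card :=
      Finset.card_pos.2 ⟨ω, by simp⟩
    have : 0 < Fintype.card Ω := Fintype.card_pos
    positivity
  · have hdeg : ∀ s ∈ f.support, s.degree ≤ t := fun s hs => (MvPolynomial.le_totalDegree hs).trans hf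
    -- `p` need not be injective; the weights count its fibres.
    have hsum : ∑ x ∈ Finset.univ.image p,
        ((Finset.univ.filter fun ω => p ω = x).card : ℝ) / Fintype.card Ω * MvPolynomial.eval x f =
        (∑ ω, MvPolynomial.eval (p ω) f) / Fintype.card Ω := by
      rw [Finset.sum_comp (fun x => MvPolynomial.eval x f) p, Finset.sum_div]
      exact Finset.sum_congr rfl fun x _ => by rw [nsmul_eq_mul]; ring
    rw [hsum]
    simp only [MvPolynomial.eval_eq']
    have hint : ∀ s ∈ f.support,
        Integrable (fun x : Fin d → ℝ => f.coeff s * ∏ i, x i ^ s i) μ := fun s hs =>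
      (h s (hdeg s hs)).1.const_mul _
    refine ⟨integrable_finsetSum _ hint, ?_⟩
    rw [integral_finsetSum _ hint, Finset.sum_comm, Finset.sum_div]
    refine Finset.sum_congr rfl fun s hs => ?_
    rw [integral_const_mul, (h s (hdeg s hs)).2, ← Finset.mul_sum, mul_div_assoc]

/-- A one-dimensional Gaussian quadrature with equal weights on a family of `2 ^ n` points yields
Gaussian designs in every dimension `d`, of size `O(d ^ s)` for degree `s + 1`. -/
theorem exists_gaussianDesign_card_le {s n : ℕ} {φ : (Fin n → ZMod 2) → ℝ}
    (hφ : ∀ j ≤ s + 1, (∑ a, φ a ^ j) / 2 ^ n = ∫ x, x ^ j ∂gaussianReal 0 (1 / 2))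
    {d : ℕ} (hd : 2 ≤ d) :
    ∃ X : Finset (Fin d → ℝ), IsGaussianDesign (s + 1) X ∧
      X.card ≤ 2 ^ n * (2 ^ (n + 1) * d) ^ s := by
  have hclog : 0 < Nat.clog 2 d := Nat.clog_pos one_lt_two hd
  -- This exponent gives `K` at least `d` elements and a surjection onto F_2^n.
  obtain ⟨K, _, _, L, hK, hL⟩ := exists_field_card_two_pow n (n + Nat.clog 2 d)
    (by omega) (Nat.le_add_right _ _)
  have hdK : Fintype.card (Fin d) ≤ Fintype.card K := by
    rw [hK, Fintype.card_fin]
    exact (Nat.le_pow_clog one_lt_two d).trans (Nat.pow_le_pow_right two_pos (by omega))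
  obtain ⟨x⟩ := Function.Embedding.nonempty_of_card_le hdK
  let p : (Fin n → ZMod 2) × (Fin s → K) → Fin d → ℝ := fun ω i => φ (arraySymbol L s (x i) ω)
  refine ⟨Finset.univ.image p, ⟨_, isWeightedDesign_image p fun e he => ?_⟩, ?_⟩
  · rw [gaussianMeasure_eq_pi]
    refine ⟨Integrable.fintype_prod (f := fun i (y : ℝ) => y ^ e i)
      fun i => integrable_pow_gaussianReal _ _ _, ?_⟩
    rw [integral_fintype_prod_eq_prod fun i (y : ℝ) => y ^ e i]
    have hcard : e.support.card ≤ s + 1 := by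
      refine le_trans ?_ he
      rw [Finsupp.degree_apply, Finset.card_eq_sum_ones]
      exact Finset.sum_le_sum fun i hi => Nat.one_le_iff_ne_zero.2 (Finsupp.mem_support_iff.1 hi)
    have hsupp : ∀ (F : Fin d → ℕ → ℝ), (∀ i, F i 0 = 1) →
        ∏ i ∈ e.support, F i (e i) = ∏ i, F i (e i) := fun F hF =>
      Finset.prod_subset (Finset.subset_univ _) fun i _ hi => by
        rw [Finsupp.notMem_support_iff.1 hi, hF]
    have havg := arraySymbol_average_prod L hL s e.support hcard x x.injective
      fun i a => φ a ^ e i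
    have hleft : ∀ ω : (Fin n → ZMod 2) × (Fin s → K), ∏ i ∈ e.support,
        φ (arraySymbol L s (x i) ω) ^ e i = ∏ i, p ω i ^ e i := fun ω =>
      hsupp (fun i k => p ω i ^ k) fun i => pow_zero _
    simp only [hleft] at havg
    rw [havg, ← hsupp (fun _ k => ∫ y, y ^ k ∂gaussianReal 0 (1 / 2)) (by simp)]
    refine Finset.prod_congr rfl fun i _ => ?_
    rw [← hφ _ ((Finsupp.le_degree i e).trans he)]
    simp [ZMod.card]
  · have h2 : 2 ^ (n + Nat.clog 2 d) ≤ 2 ^ (n + 1) * d := by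
      have := (Nat.pow_pred_clog_lt_self one_lt_two hd).le
      obtain ⟨c, hc⟩ := Nat.exists_eq_succ_of_ne_zero hclog.ne'
      rw [hc, Nat.pred_succ] at this
      rw [hc, Nat.succ_eq_add_one, ← add_assoc, pow_add, pow_add 2 n 1, pow_add]
      nlinarith [Nat.mul_le_mul_left (2 ^ n * 2) this]
    calc (Finset.univ.image p).card ≤ Fintype.card ((Fin n → ZMod 2) × (Fin s → K)) :=
          Finset.card_image_le
      _ = 2 ^ n * (2 ^ (n + Nat.clog 2 d)) ^ s := by simp [hK, ZMod.card]
      _ ≤ 2 ^ n * (2 ^ (n + 1) * d) ^ s := by gcongr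

end GaussianDesign

theorem theorem4p10 (t : ℕ) (ht : 2 ≤ t) :
    ∃ M : ℕ, ∀ q : ℕ, IsPrimePow q → M ≤ q →
      ∃ N : ℕ → ℕ,
        (∀ d : ℕ, t ≤ d →
          (∃ X : Finset (Fin d → ℝ), X.card = N d ∧ IsGaussianDesign t X) ∧
            N d < q ^ t * d ^ (t - 1)) ∧
        (fun d : ℕ => (N d : ℝ)) =O[Filter.atTop] (fun d : ℕ => (d : ℝ) ^ (t - 1)) := by
  obtain ⟨s, rfl⟩ : ∃ s, t = s + 1 := ⟨t - 1, by omega⟩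
  have : (ProbabilityTheory.gaussianReal 0 (1 / 2)).IsOpenPosMeasure :=
    (ProbabilityTheory.gaussianReal_absolutelyContinuous' 0 (by norm_num)).isOpenPosMeasure
  obtain ⟨n, φ, hφ⟩ := exists_dyadic_uniform_moments (s + 1)
    (ProbabilityTheory.gaussianReal 0 (1 / 2)) (integrable_pow_gaussianReal 0 (1 / 2))
  -- The extra factor 2 over the alphabet size makes the final inequality strict.
  refine ⟨2 ^ (n + 1), fun q _ hq => ?_⟩
  choose X hX hcard using fun d : {d : ℕ // s + 1 ≤ d} =>
    exists_gaussianDesign_card_le hφ (ht.trans d.2)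
  have hbound : ∀ d, (X d).card < q ^ (s + 1) * (d : ℕ) ^ s := fun d => by
    have hd : 0 < (d : ℕ) := by have := d.2; omega
    calc (X d).card ≤ 2 ^ n * (2 ^ (n + 1) * d) ^ s := hcard d
      _ < 2 ^ (n + 1) * (2 ^ (n + 1) * d) ^ s := by
          gcongr
          · norm_num
          · omega
      _ = (2 ^ (n + 1)) ^ (s + 1) * (d : ℕ) ^ s := by ring
      _ ≤ q ^ (s + 1) * (d : ℕ) ^ s := by gcongr
  refine ⟨fun d => if h : s + 1 ≤ d then (X ⟨d, h⟩).card else 0, fun d hd => ?_, ?_⟩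
  · simp only [hd, dif_pos, Nat.add_sub_cancel]
    exact ⟨⟨X ⟨d, hd⟩, rfl, hX _⟩, hbound ⟨d, hd⟩⟩
  · refine Asymptotics.IsBigO.of_bound ((q : ℝ) ^ (s + 1)) ?_
    filter_upwards [Filter.eventually_ge_atTop (s + 1)] with d hd
    simp only [hd, dif_pos, Nat.add_sub_cancel, Real.norm_natCast, norm_pow]
    exact_mod_cast (hbound ⟨d, hd⟩).le
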